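/- Label the points of a convex $N$-gon ($N\ge 3$) by $1,\dots,N$ in cyclic order. The associahedron $\mathcal G_N$ is the graph whose nodes are all triangulations of the $N$-gon, with an edge between any two triangulations that differ in a flip, i.e., one arises from the other by removing an edge shared by two triangles and replacing it by the other diagonal of the resulting 4-gon. For a sequence $\alpha=(\alpha_1,\dots,\alpha_\ell)$ of positive integers of even length with $N=\sum_i\alpha_i$, color the first $\alpha_1$ points red, the next $\alpha_2$ points blue, the next $\alpha_3$ points red, and so on alternatingly. Let $\mathcal F_\alpha$ be the subgraph of $\mathcal G_N$ induced by all triangulations in which no triangle has its three points of the same color. Theorem. For $\alpha=(a,1,1,1,1,1)$, the graph $\mathcal F_\alpha$ has no Hamilton cycle for any integer $a\ge 1$, but it has a Hamilton path for $a=2$ and for every integer $a\ge 4$. -/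

import Mathlib

/-- Two segments `(i, j)` and `(k, l)` (with `i < j` and `k < l`) between points of a convex `N`-gon
cross in their interiors: their endpoints are distinct and interleave. -/
def SegmentsCross {N : ℕ} (e f : Fin N × Fin N) : Prop :=
  (e.1 < f.1 ∧ f.1 < e.2 ∧ e.2 < f.2) ∨ (f.1 < e.1 ∧ e.1 < f.2 ∧ f.2 < e.2)

/-- `T` is (the edge set of) a triangulation of the convex polygon with vertices `0, …, N - 1` in
cyclic order: an inclusion-maximal set of pairwise non-crossing segments between the points. A
segment between `i < j` is represented by the pair `(i, j)`; the boundary edges cross nothing, so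
they all belong to `T`. -/
def IsTriangulation {N : ℕ} (T : Finset (Fin N × Fin N)) : Prop :=
  (∀ e ∈ T, e.1 < e.2) ∧
  (∀ e ∈ T, ∀ f ∈ T, ¬ SegmentsCross e f) ∧
  (∀ e : Fin N × Fin N, e.1 < e.2 → (∀ f ∈ T, ¬ SegmentsCross e f) → e ∈ T)

/-- The triangulations of the convex `N`-gon. -/
abbrev Triangulation (N : ℕ) : Type := {T : Finset (Fin N × Fin N) // IsTriangulation T}

/-- `T` and `T'` differ in a flip: for some points `i < j < k < l` whose quadrilateral has all its
four sides in `T`, one of the two diagonals `(i, k)`, `(j, l)` belongs to `T`, and `T'` arises by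
replacing it by the other one. -/
def IsFlip {N : ℕ} (T T' : Finset (Fin N × Fin N)) : Prop :=
  ∃ i j k l : Fin N, i < j ∧ j < k ∧ k < l ∧
    (i, j) ∈ T ∧ (j, k) ∈ T ∧ (k, l) ∈ T ∧ (i, l) ∈ T ∧
    (((i, k) ∈ T ∧ T' = insert (j, l) (T.erase (i, k))) ∨
      ((j, l) ∈ T ∧ T' = insert (i, k) (T.erase (j, l))))

/-- The associahedron `𝒢_N`: the flip graph on all triangulations of the convex `N`-gon. (Flips are
reversible and change the triangulation; `SimpleGraph.fromRel` makes this syntactic.) -/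
def associahedron (N : ℕ) : SimpleGraph (Triangulation N) :=
  SimpleGraph.fromRel fun T T' => IsFlip T.1 T'.1

/-- The color pattern encoded by a sequence `(α₁, …, α_ℓ)`: `α₁` points of color `c`, then `α₂`
points of the other color, and so on alternatingly. -/
def colorPattern (c : Bool) : List ℕ → List Bool
  | [] => []
  | a :: α => List.replicate a c ++ colorPattern (!c) α

theorem length_colorPattern (c : Bool) (α : List ℕ) : (colorPattern c α).length = α.sum := by
  induction α generalizing c with
  | nil => rfl
  | cons a α ih => simp [colorPattern, ih]

/-- The coloring of the `N = α₁ + ⋯ + α_ℓ` points with pattern `red^α₁ blue^α₂ red^α₃ ⋯`, where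
`true` stands for red and `false` for blue. -/
def pointColor (α : List ℕ) (i : Fin α.sum) : Bool :=
  (colorPattern true α).get (i.cast (length_colorPattern true α).symm)

/-- No triangle of `T` is monochromatic under the coloring `χ`. (In a triangulation of a convex
polygon, any three pairwise joined points form one of its triangles.) -/
def IsColorful {N : ℕ} (χ : Fin N → Bool) (T : Finset (Fin N × Fin N)) : Prop :=
  ∀ i j k : Fin N, (i, j) ∈ T → (j, k) ∈ T → (i, k) ∈ T → ¬ (χ i = χ j ∧ χ j = χ k)

/-- The graph `ℱ_α`: the subgraph of the associahedron `𝒢_N`, `N = α₁ + ⋯ + α_ℓ`, induced by the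
triangulations that are colorful for the color pattern of `α`. -/
def colorfulFlipGraph (α : List ℕ) :
    SimpleGraph {T : Triangulation α.sum | IsColorful (pointColor α) T.1} :=
  (associahedron α.sum).induce {T | IsColorful (pointColor α) T.1}

/-- `G` has a Hamilton path. -/
def HasHamiltonPath {V : Type*} [DecidableEq V] (G : SimpleGraph V) : Prop :=
  ∃ (u v : V) (p : G.Walk u v), p.IsHamiltonian

/-- `G` has a Hamilton cycle. -/
def HasHamiltonCycle {V : Type*} [DecidableEq V] (G : SimpleGraph V) : Prop :=
  ∃ (u : V) (p : G.Walk u u), p.IsHamiltonianCycle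

/-- Coordinates of the colorful triangulations for the pattern `(a, 1, 1, 1, 1, 1)`, whose points
are the red `0, …, a - 1`, `a + 1`, `a + 3` and the blue `a`, `a + 2`, `a + 4`.
`fan s t p q` is the case in which `a + 2` is joined to the points `s, …, t`, while `hex c i p q` is
the case in which it is joined to none of `0, …, a - 1`. The Booleans choose the diagonals of the
remaining two quadrilaterals. -/
inductive Node
  | fan (s t : ℕ) (p q : Bool)
  | hex (c : Bool) (i : ℕ) (p q : Bool)
  deriving DecidableEq

/-! ### Coordinates describe colorful triangulations -/

namespace Node

/-- The coordinates that occur for the pattern `(a, 1, 1, 1, 1, 1)`. -/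
def Valid (a : ℕ) : Node → Prop
  | fan s t _ _ => s ≤ t ∧ t < a
  | hex _ i _ _ => i < a

/-- The segments of the triangulation with the given coordinates. -/
def Edge (a : ℕ) : Node → ℕ → ℕ → Prop
  | fan s t p q, x, y =>
    (y = x + 1 ∧ y ≤ a + 4) ∨ (x ≤ s ∧ y = a + 4) ∨ (s ≤ x ∧ x ≤ t ∧ y = a + 2) ∨
    (t ≤ x ∧ x < a ∧ y = a) ∨
    (p = true ∧ x = s ∧ y = a + 3) ∨ (p = false ∧ x = a + 2 ∧ y = a + 4) ∨
    (q = true ∧ x = t ∧ y = a + 1) ∨ (q = false ∧ x = a ∧ y = a + 2)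
  | hex c i p q, x, y =>
    (y = x + 1 ∧ y ≤ a + 4) ∨ (x ≤ i ∧ y = a + 4) ∨ (i ≤ x ∧ x < a ∧ y = a) ∨
    (p = false ∧ x = a ∧ y = a + 4) ∨ (q = true ∧ x = a + 1 ∧ y = a + 3) ∨
    (c = false ∧ x = a + 1 ∧ y = a + 4) ∨
    (c = false ∧ p = true ∧ x = i ∧ y = a + 1) ∨
    (c = false ∧ q = false ∧ x = a + 2 ∧ y = a + 4) ∨
    (c = true ∧ x = a ∧ y = a + 3) ∨
    (c = true ∧ p = true ∧ x = i ∧ y = a + 3) ∨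
    (c = true ∧ q = false ∧ x = a ∧ y = a + 2)

instance (a : ℕ) (v : Node) (x y : ℕ) : Decidable (Edge a v x y) := by
  cases v <;> unfold Edge <;> infer_instance

variable {a : ℕ} {v : Node}

theorem Edge.lt (hv : v.Valid a) {x y : ℕ} (h : v.Edge a x y) : x < y ∧ y ≤ a + 4 := by
  cases v <;> simp only [Edge, Valid] at * <;> omega

theorem edge_root (a : ℕ) (v : Node) : v.Edge a 0 (a + 4) := by
  cases v <;> exact Or.inr (Or.inl ⟨Nat.zero_le _, rfl⟩)

theorem edge_noncrossing (hv : v.Valid a) {x y z w : ℕ} (h : v.Edge a x y) (h' : v.Edge a z w) :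
    ¬ (x < z ∧ z < y ∧ y < w) := by
  rcases v with ⟨s, t, p, q⟩ | ⟨c, i, p, q⟩ <;> simp only [Edge, Valid] at * <;> rintro ⟨h1, h2, h3⟩
  · cases p <;> cases q <;> simp only [true_and, false_and, false_or, or_false, reduceCtorEq] at * <;> omega
  · cases c <;> cases p <;> cases q <;>
      simp only [true_and, false_and, false_or, or_false, reduceCtorEq] at * <;> omega

/-- A triangle below each segment is what `mem_of_noncrossing_of_apex` needs to turn non-crossing
into maximality. -/
theorem edge_apex (hv : v.Valid a) {x y : ℕ} (h : v.Edge a x y) (hxy : x + 1 < y) :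
    ∃ k, x < k ∧ k < y ∧ v.Edge a x k ∧ v.Edge a k y := by
  rcases v with ⟨s, t, p, q⟩ | ⟨c, i, p, q⟩ <;> simp only [Edge, Valid] at h hv
  · rcases h with h | h | h | h | h | h | h | h
    · omega
    · by_cases hx : x = s
      · cases p
        · exact ⟨a + 2, by omega, by omega, by grind [Edge], by grind [Edge]⟩
        · exact ⟨a + 3, by omega, by omega, by grind [Edge], by grind [Edge]⟩
      · exact ⟨x + 1, by omega, by omega, by grind [Edge], by grind [Edge]⟩
    · by_cases hx : x = t
      · cases q
        · exact ⟨a, by omega, by omega, by grind [Edge], by grind [Edge]⟩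
        · exact ⟨a + 1, by omega, by omega, by grind [Edge], by grind [Edge]⟩
      · exact ⟨x + 1, by omega, by omega, by grind [Edge], by grind [Edge]⟩
    · exact ⟨x + 1, by omega, by omega, by grind [Edge], by grind [Edge]⟩
    · exact ⟨a + 2, by omega, by omega, by grind [Edge], by grind [Edge]⟩
    · exact ⟨a + 3, by omega, by omega, by grind [Edge], by grind [Edge]⟩
    · exact ⟨a, by omega, by omega, by grind [Edge], by grind [Edge]⟩
    · exact ⟨a + 1, by omega, by omega, by grind [Edge], by grind [Edge]⟩
  · rcases h with h | h | h | h | h | h | h | h | h | h | h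
    · omega
    · by_cases hx : x = i
      · cases p
        · exact ⟨a, by omega, by omega, by grind [Edge], by grind [Edge]⟩
        · cases c
          · exact ⟨a + 1, by omega, by omega, by grind [Edge], by grind [Edge]⟩
          · exact ⟨a + 3, by omega, by omega, by grind [Edge], by grind [Edge]⟩
      · exact ⟨x + 1, by omega, by omega, by grind [Edge], by grind [Edge]⟩
    · exact ⟨x + 1, by omega, by omega, by grind [Edge], by grind [Edge]⟩
    · cases c
      · exact ⟨a + 1, by omega, by omega, by grind [Edge], by grind [Edge]⟩
      · exact ⟨a + 3, by omega, by omega, by grind [Edge], by grind [Edge]⟩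
    · exact ⟨a + 2, by omega, by omega, by grind [Edge], by grind [Edge]⟩
    · cases q
      · exact ⟨a + 2, by omega, by omega, by grind [Edge], by grind [Edge]⟩
      · exact ⟨a + 3, by omega, by omega, by grind [Edge], by grind [Edge]⟩
    · exact ⟨a, by omega, by omega, by grind [Edge], by grind [Edge]⟩
    · exact ⟨a + 3, by omega, by omega, by grind [Edge], by grind [Edge]⟩
    · cases q
      · exact ⟨a + 2, by omega, by omega, by grind [Edge], by grind [Edge]⟩
      · exact ⟨a + 1, by omega, by omega, by grind [Edge], by grind [Edge]⟩
    · exact ⟨a, by omega, by omega, by grind [Edge], by grind [Edge]⟩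
    · exact ⟨a + 1, by omega, by omega, by grind [Edge], by grind [Edge]⟩

/-- The points of red color. -/
def Red (a x : ℕ) : Prop := x < a ∨ x = a + 1 ∨ x = a + 3

/-- This list leaves only three shapes of a potential monochromatic triangle to exclude in
`edge_colorful`. -/
theorem edge_monochromatic (hv : v.Valid a) {x y : ℕ} (h : v.Edge a x y)
    (hc : Red a x ↔ Red a y) : (y = x + 1 ∧ y < a) ∨ (x < a ∧ (y = a + 1 ∨ y = a + 3)) ∨
      (x = a + 1 ∧ y = a + 3) ∨ (x = a ∧ (y = a + 2 ∨ y = a + 4)) ∨ (x = a + 2 ∧ y = a + 4) := by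
  rcases v with ⟨s, t, p, q⟩ | ⟨c, i, p, q⟩ <;> simp only [Edge, Valid, Red] at *
  · rcases h with h | h | h | h | h | h | h | h <;> omega
  · rcases h with h | h | h | h | h | h | h | h | h | h | h <;> omega

theorem edge_colorful (hv : v.Valid a) {x y z : ℕ} (hxy : v.Edge a x y) (hyz : v.Edge a y z)
    (hxz : v.Edge a x z) : ¬ ((Red a x ↔ Red a y) ∧ (Red a y ↔ Red a z)) := by
  rintro ⟨h, h'⟩
  have H : (x < a ∧ y = a + 1 ∧ z = a + 3) ∨ (x = a ∧ y = a + 2 ∧ z = a + 4) ∨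
      (y = x + 1 ∧ y < a ∧ (z = a + 1 ∨ z = a + 3)) := by
    have h1 := edge_monochromatic hv hxy h
    have h2 := edge_monochromatic hv hyz h'
    have h3 := edge_monochromatic hv hxz (h.trans h')
    omega
  rcases H with ⟨hx, rfl, rfl⟩ | ⟨rfl, rfl, rfl⟩ | ⟨rfl, hy, hz⟩
  · rcases v with ⟨s, t, p, q⟩ | ⟨c, i, p, q⟩
    · simp only [Edge, Valid] at *
      omega
    · cases c <;> simp only [Edge, Valid] at * <;> simp at * <;> omega
  · rcases v with ⟨s, t, p, q⟩ | ⟨c, i, p, q⟩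
    · simp only [Edge, Valid] at *
      omega
    · cases c <;> cases q <;> simp only [Edge, Valid] at * <;> simp at * <;> omega
  · rcases v with ⟨s, t, p, q⟩ | ⟨c, i, p, q⟩ <;> simp only [Edge, Valid] at * <;> omega

end Node

/-! ### Maximality of non-crossing sets and triangles below segments -/

/-- In a set of segments that contains `(0, m)` and, below each segment, a triangle, every segment
that crosses none of them belongs to it. -/
theorem mem_of_noncrossing_of_apex {E : ℕ → ℕ → Prop} {m : ℕ} (root : E 0 m)
    (apex : ∀ x y, E x y → x + 1 < y → ∃ k, x < k ∧ k < y ∧ E x k ∧ E k y) {u v : ℕ}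
    (huv : u < v) (hv : v ≤ m)
    (h : ∀ x y, E x y → ¬ (x < u ∧ u < y ∧ y < v) ∧ ¬ (u < x ∧ x < v ∧ v < y)) : E u v := by
  suffices H : ∀ d x y, y - x ≤ d → E x y → x ≤ u → v ≤ y → E u v from
    H m 0 m (by omega) root (by omega) hv
  intro d
  induction d with
  | zero => intro x y _ _ _ _; omega
  | succ d ih =>
    intro x y hd hxy hx hy
    by_cases hc : x = u ∧ v = y
    · exact hc.1 ▸ hc.2 ▸ hxy
    obtain ⟨k, hk, hk', h1, h2⟩ := apex x y hxy (by omega)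
    -- If neither `(x, k)` nor `(k, y)` lies above `(u, v)`, then `u < k < v`. Since `x < u` or `v <
    -- y`, one of these two sides crosses `(u, v)`.
    have c1 := h x k h1
    have c2 := h k y h2
    rcases le_or_gt v k with hvk | hvk
    · exact ih x k (by omega) h1 hx hvk
    rcases le_or_gt k u with hku | hku
    · exact ih k y (by omega) h2 hku hy
    omega

/-- A maximal non-crossing set of segments contains a triangle below each of its segments. -/
theorem exists_apex_of_maximal {E : ℕ → ℕ → Prop} {m : ℕ} (hlt : ∀ x y, E x y → x < y ∧ y ≤ m)
    (hcr : ∀ x y z w, E x y → E z w → ¬ (x < z ∧ z < y ∧ y < w))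
    (hmax : ∀ x y, x < y → y ≤ m →
      (∀ z w, E z w → ¬ (x < z ∧ z < y ∧ y < w) ∧ ¬ (z < x ∧ x < w ∧ w < y)) → E x y)
    {x y : ℕ} (h : E x y) (hxy : x + 1 < y) : ∃ k, x < k ∧ k < y ∧ E x k ∧ E k y := by
  classical
  have hy := (hlt x y h).2
  have h1 : E x (x + 1) := by
    refine hmax _ _ (by omega) (by omega) fun z w hzw => ?_
    omega
  -- A segment crossing `(k, y)` but neither `(x, y)` nor `(x, k)` starts at `x` and ends strictly
  -- between `k` and `y`, against the choice of `k`.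
  set k := Nat.findGreatest (fun k => E x k) (y - 1) with hk
  have hxk : E x k := Nat.findGreatest_spec (P := fun k => E x k) (by omega : x + 1 ≤ y - 1) h1
  have hk1 : x < k := (hlt _ _ hxk).1
  have hk2 : k ≤ y - 1 := Nat.findGreatest_le _
  refine ⟨k, hk1, by omega, hxk, hmax _ _ (by omega) hy fun z w hzw => ⟨?_, ?_⟩⟩
  · rintro ⟨h2, h3, h4⟩
    exact hcr _ _ _ _ h hzw (by omega)
  · rintro ⟨h2, h3, h4⟩
    have c1 := hcr _ _ _ _ hzw h
    have c2 := hcr _ _ _ _ hxk hzw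
    obtain rfl : z = x := by omega
    exact Nat.findGreatest_is_greatest (P := fun k => E z k) (k := w) (n := y - 1)
      (by omega) (by omega) hzw

/-! ### Every colorful triangulation has coordinates -/

namespace Node

/-- The coordinates are read off from the last `s < a` joined to `a + 4` and the apex of the
triangle below `(s, a + 4)`. One inclusion suffices, because the segments of `v` are themselves a
maximal non-crossing set. -/
theorem exists_edge_imp_of_maximal {a : ℕ} (ha : 1 ≤ a) {E : ℕ → ℕ → Prop}
    (hlt : ∀ x y, E x y → x < y ∧ y ≤ a + 4)
    (hcr : ∀ x y z w, E x y → E z w → ¬ (x < z ∧ z < y ∧ y < w))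
    (hmax : ∀ x y, x < y → y ≤ a + 4 →
      (∀ z w, E z w → ¬ (x < z ∧ z < y ∧ y < w) ∧ ¬ (z < x ∧ x < w ∧ w < y)) → E x y)
    (hcol : ∀ x y z, E x y → E y z → E x z → ¬ ((Red a x ↔ Red a y) ∧ (Red a y ↔ Red a z))) :
    ∃ v : Node, v.Valid a ∧ ∀ x y, v.Edge a x y → E x y := by
  classical
  have apex : ∀ x y, E x y → x + 1 < y → ∃ k, x < k ∧ k < y ∧ E x k ∧ E k y :=
    fun x y => exists_apex_of_maximal hlt hcr hmax
  have bdry : ∀ x, x < a + 4 → E x (x + 1) := fun x hx =>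
    hmax _ _ (by omega) (by omega) fun z w hzw => by omega
  have root : E 0 (a + 4) := hmax _ _ (by omega) (by omega) fun z w hzw => by
    have := hlt _ _ hzw
    omega
  -- A longer segment would have a triangle below it with three red points.
  have short : ∀ x y, E x y → y < a → y = x + 1 := by
    intro x y h hy
    by_contra hne
    have := hlt _ _ h
    obtain ⟨k, h1, h2, h3, h4⟩ := apex x y h (by omega)
    exact hcol _ _ _ h3 h4 h (by simp only [Red]; omega)
  -- the points joined to a given blue point form an interval
  have fan : ∀ b x s, a ≤ b → s < a → E x b → E s b → ∀ y, x ≤ y → y ≤ s → E y b := by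
    intro b x s hb hs hx hsb y hxy
    induction y, hxy using Nat.le_induction with
    | base => exact fun _ => hx
    | succ y hxy ih =>
      intro hy
      have hyb := ih (by omega)
      obtain ⟨k, h1, h2, h3, h4⟩ := apex y b hyb (by omega)
      have c := hcr _ _ _ _ h3 hsb
      have := short y k h3 (by omega)
      exact this ▸ h4
  -- the last point joined to a given blue point, and the triangle below that segment
  have last : ∀ b x, x < a → E x b → ∃ s, x ≤ s ∧ s < a ∧ E s b ∧
      ∀ k, s < k → E s k → E k b → a ≤ k := by
    intro b x hx hxb
    refine ⟨Nat.findGreatest (fun k => E k b) (a - 1),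
      Nat.le_findGreatest (P := fun k => E k b) (by omega) hxb, ?_, ?_, ?_⟩
    · have := Nat.findGreatest_le (P := fun k => E k b) (a - 1)
      omega
    · exact Nat.findGreatest_spec (P := fun k => E k b) (by omega : x ≤ a - 1) hxb
    · intro k hk _ hkb
      by_contra hka
      exact Nat.findGreatest_is_greatest (P := fun k => E k b) hk (by omega) hkb
  -- Both ends are red, so the apex must be blue.
  have toR : ∀ x r, x < a → (r = a + 1 ∨ r = a + 3) → E x r → ∃ k, E x k ∧ E k r ∧ a ≤ k ∧ k < r ∧
      k ≠ a + 1 := by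
    intro x r hx hr h
    obtain ⟨k, h1, h2, h3, h4⟩ := apex x r h (by omega)
    have := hcol _ _ _ h3 h4 h
    simp only [Red] at this
    exact ⟨k, h3, h4, by omega, h2, by omega⟩
  -- The right end of this interval is `a - 1`, joined to `a` by a boundary edge.
  have fan1 : ∀ t, t < a → E t a → ∀ y, t ≤ y → y < a → E y a := fun t ht h y h1 h2 =>
    fan a t (a - 1) le_rfl (by omega) h
      (by have := bdry (a - 1) (by omega); rwa [Nat.sub_add_cancel ha] at this) y h1 (by omega)
  obtain ⟨s, -, hs, hsb, hlast⟩ := last (a + 4) 0 (by omega) root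
  have fan3 : ∀ y, y ≤ s → E y (a + 4) := fun y hy =>
    fan (a + 4) 0 s (by omega) hs root hsb y (by omega) hy
  have hFan : E s (a + 2) → ∀ p : Bool, (p = true → E s (a + 3)) → (p = false → E (a + 2) (a + 4)) →
      ∃ v : Node, v.Valid a ∧ ∀ x y, v.Edge a x y → E x y := by
    intro h2 p hp hp'
    obtain ⟨t, hst, ht, htb, htl⟩ := last (a + 2) s hs h2
    have key : ∃ q : Bool, E t a ∧ (q = true → E t (a + 1)) ∧ (q = false → E a (a + 2)) := by
      obtain ⟨k, h1, h2, h3, h4⟩ := apex t (a + 2) htb (by omega)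
      have := htl k h1 h3 h4
      rcases (by omega : k = a ∨ k = a + 1) with rfl | rfl
      · exact ⟨false, h3, by simp, fun _ => h4⟩
      · obtain ⟨k', h5, h6, h7, h8, h9⟩ := toR t (a + 1) ht (by omega) h3
        obtain rfl : k' = a := by omega
        exact ⟨true, h5, fun _ => h3, by simp⟩
    obtain ⟨q, hta, hq, hq'⟩ := key
    refine ⟨.fan s t p q, ⟨hst, ht⟩, fun x y h => ?_⟩
    rcases h with h | h | h | h | h | h | h | h
    · obtain ⟨rfl, h⟩ := h
      exact bdry x (by omega)
    · obtain ⟨h, rfl⟩ := h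
      exact fan3 x h
    · obtain ⟨h, h', rfl⟩ := h
      exact fan (a + 2) s t (by omega) ht h2 htb x h h'
    · obtain ⟨h, h', rfl⟩ := h
      exact fan1 t ht hta x h h'
    · obtain ⟨h, rfl, rfl⟩ := h
      exact hp h
    · obtain ⟨h, rfl, rfl⟩ := h
      exact hp' h
    · obtain ⟨h, rfl, rfl⟩ := h
      exact hq h
    · obtain ⟨h, rfl, rfl⟩ := h
      exact hq' h
  have hHexF : E s a → E (a + 1) (a + 4) → ∀ p : Bool, (p = true → E s (a + 1)) →
      (p = false → E a (a + 4)) → ∃ v : Node, v.Valid a ∧ ∀ x y, v.Edge a x y → E x y := by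
    intro h1 h2 p hp hp'
    have key : ∃ q : Bool, (q = true → E (a + 1) (a + 3)) ∧ (q = false → E (a + 2) (a + 4)) := by
      obtain ⟨k, h3, h4, h5, h6⟩ := apex _ _ h2 (by omega)
      rcases (by omega : k = a + 2 ∨ k = a + 3) with rfl | rfl
      · exact ⟨false, by simp, fun _ => h6⟩
      · exact ⟨true, fun _ => h5, by simp⟩
    obtain ⟨q, hq, hq'⟩ := key
    refine ⟨.hex false s p q, hs, fun x y h => ?_⟩
    simp only [Edge, true_and, reduceCtorEq, false_and, or_false] at h
    rcases h with h | h | h | h | h | h | h | h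
    · obtain ⟨rfl, h⟩ := h
      exact bdry x (by omega)
    · obtain ⟨h, rfl⟩ := h
      exact fan3 x h
    · obtain ⟨h, h', rfl⟩ := h
      exact fan1 s hs h1 x h h'
    · obtain ⟨h, rfl, rfl⟩ := h
      exact hp' h
    · obtain ⟨h, rfl, rfl⟩ := h
      exact hq h
    · obtain ⟨rfl, rfl⟩ := h
      exact h2
    · obtain ⟨h, rfl, rfl⟩ := h
      exact hp h
    · obtain ⟨h, rfl, rfl⟩ := h
      exact hq' h
  have hHexT : E s a → E a (a + 3) → ∀ p : Bool, (p = true → E s (a + 3)) →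
      (p = false → E a (a + 4)) → ∃ v : Node, v.Valid a ∧ ∀ x y, v.Edge a x y → E x y := by
    intro h1 h2 p hp hp'
    have key : ∃ q : Bool, (q = true → E (a + 1) (a + 3)) ∧ (q = false → E a (a + 2)) := by
      obtain ⟨k, h3, h4, h5, h6⟩ := apex _ _ h2 (by omega)
      rcases (by omega : k = a + 1 ∨ k = a + 2) with rfl | rfl
      · exact ⟨true, fun _ => h6, by simp⟩
      · exact ⟨false, by simp, fun _ => h5⟩
    obtain ⟨q, hq, hq'⟩ := key
    refine ⟨.hex true s p q, hs, fun x y h => ?_⟩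
    simp only [Edge, true_and, reduceCtorEq, false_and, false_or] at h
    rcases h with h | h | h | h | h | h | h | h
    · obtain ⟨rfl, h⟩ := h
      exact bdry x (by omega)
    · obtain ⟨h, rfl⟩ := h
      exact fan3 x h
    · obtain ⟨h, h', rfl⟩ := h
      exact fan1 s hs h1 x h h'
    · obtain ⟨h, rfl, rfl⟩ := h
      exact hp' h
    · obtain ⟨h, rfl, rfl⟩ := h
      exact hq h
    · obtain ⟨rfl, rfl⟩ := h
      exact h2
    · obtain ⟨h, rfl, rfl⟩ := h
      exact hp h
    · obtain ⟨h, rfl, rfl⟩ := h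
      exact hq' h
  obtain ⟨k, h1, h2, h3, h4⟩ := apex s (a + 4) hsb (by omega)
  have := hlast k h1 h3 h4
  rcases (by omega : k = a ∨ k = a + 1 ∨ k = a + 2 ∨ k = a + 3) with rfl | rfl | rfl | rfl
  · obtain ⟨l, h5, h6, h7, h8⟩ := apex k (k + 4) h4 (by omega)
    have := hcol _ _ _ h7 h8 h4
    simp only [Red] at this
    -- Here `k` is `a`; the apex `a + 2` would give an all-blue triangle.
    rcases (by omega : l = k + 1 ∨ l = k + 3) with rfl | rfl
    · exact hHexF h3 h8 false (by simp) fun _ => h4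
    · exact hHexT h3 h7 false (by simp) fun _ => h4
  · obtain ⟨l, h5, h6, h7, h8, h9⟩ := toR s (a + 1) hs (by omega) h3
    obtain rfl : l = a := by omega
    exact hHexF h5 h4 true (fun _ => h3) (by simp)
  · exact hFan h3 false (by simp) fun _ => h4
  · obtain ⟨l, h5, h6, h7, h8, h9⟩ := toR s (a + 3) hs (by omega) h3
    rcases (by omega : l = a ∨ l = a + 2) with rfl | rfl
    · exact hHexT h5 h6 true (fun _ => h3) (by simp)
    · exact hFan h5 true (fun _ => h3) (by simp)

end Node

/-! ### Triangulations and flips in coordinates -/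

namespace Node

/-- The set of segments with the given coordinates, between points of an `N`-gon. -/
def segments (a N : ℕ) (v : Node) : Finset (Fin N × Fin N) :=
  Finset.univ.filter fun e => v.Edge a e.1 e.2

@[simp]
theorem mem_segments {a N : ℕ} {v : Node} {e : Fin N × Fin N} :
    e ∈ v.segments a N ↔ v.Edge a e.1 e.2 := by
  simp [segments]

variable {a N : ℕ} {v w : Node}

theorem isTriangulation_segments (hN : N = a + 5) (hv : v.Valid a) :
    IsTriangulation (v.segments a N) := by
  refine ⟨fun e he => (Edge.lt hv (mem_segments.1 he)).1, fun e he f hf => ?_, fun e he h => ?_⟩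
  · rw [mem_segments] at he hf
    exact not_or.2 ⟨edge_noncrossing hv he hf, edge_noncrossing hv hf he⟩
  · rw [mem_segments]
    refine mem_of_noncrossing_of_apex (m := a + 4) (edge_root a v) (fun x y => edge_apex hv) he
      (by omega) fun x y hxy => ?_
    have hlt := Edge.lt hv hxy
    have := h (⟨x, by omega⟩, ⟨y, by omega⟩) (mem_segments.2 hxy)
    simp only [SegmentsCross, Fin.lt_def, not_or] at this
    exact ⟨this.2, this.1⟩

theorem isColorful_segments {χ : Fin N → Bool} (hχ : ∀ i, χ i = true ↔ Red a i)
    (hv : v.Valid a) : IsColorful χ (v.segments a N) := by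
  intro i j k hij hjk hik h
  rw [mem_segments] at hij hjk hik
  refine edge_colorful hv hij hjk hik ?_
  rw [← hχ, ← hχ, ← hχ, h.1, h.2]
  exact ⟨Iff.rfl, Iff.rfl⟩

theorem exists_eq_segments (hN : N = a + 5) (ha : 1 ≤ a) {χ : Fin N → Bool}
    (hχ : ∀ i, χ i = true ↔ Red a i) {T : Finset (Fin N × Fin N)} (hT : IsTriangulation T)
    (hc : IsColorful χ T) : ∃ v : Node, v.Valid a ∧ T = v.segments a N := by
  have key : ∃ v : Node, v.Valid a ∧ ∀ x y, v.Edge a x y →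
      ∃ (hx : x < N) (hy : y < N), (⟨x, hx⟩, ⟨y, hy⟩) ∈ T := by
    refine exists_edge_imp_of_maximal ha ?_ ?_ ?_ ?_
    · rintro x y ⟨hx, hy, h⟩
      have := hT.1 _ h
      simp only [Fin.lt_def] at this
      omega
    · rintro x y z w ⟨hx, hy, h⟩ ⟨hz, hw, h'⟩ hh
      exact hT.2.1 _ h _ h' (Or.inl hh)
    · intro x y hxy hy h
      refine ⟨by omega, by omega, hT.2.2 _ hxy fun f hf => ?_⟩
      exact not_or.2 (h f.1 f.2 ⟨f.1.2, f.2.2, hf⟩)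
    · rintro x y z ⟨hx, hy, h⟩ ⟨_, hz, h'⟩ ⟨_, _, h''⟩ hh
      rw [← hχ ⟨x, hx⟩, ← hχ ⟨y, hy⟩, ← hχ ⟨z, hz⟩, ← Bool.eq_iff_iff, ← Bool.eq_iff_iff] at hh
      exact hc _ _ _ h h' h'' hh
  obtain ⟨v, hv, hE⟩ := key
  refine ⟨v, hv, Finset.Subset.antisymm (fun e he => ?_) fun e he => ?_⟩
  · refine (isTriangulation_segments hN hv).2.2 e (hT.1 e he) fun f hf => ?_
    rw [mem_segments] at hf
    obtain ⟨hx, hy, hf⟩ := hE _ _ hf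
    exact hT.2.1 _ he _ hf
  · obtain ⟨hx, hy, he⟩ := hE _ _ (mem_segments.1 he)
    exact he

theorem edge_fan_iff {s t x : ℕ} {p q : Bool} (hx : x < a) :
    (fan s t p q).Edge a x (a + 2) ↔ s ≤ x ∧ x ≤ t := by
  simp only [Edge]
  grind

theorem not_edge_hex {i x : ℕ} {c p q : Bool} (hx : x < a) :
    ¬ (hex c i p q).Edge a x (a + 2) := by
  simp only [Edge]
  grind

theorem edge_hex_iff {i x : ℕ} {c p q : Bool} (hx : x < a) :
    (hex c i p q).Edge a x (a + 4) ↔ x ≤ i := by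
  simp only [Edge]
  grind

/-- The neighbors of `a + 2` below `a` separate fans from hexes and determine `s, t`; the neighbors
of `a + 4` determine `i`. The Booleans are visible on single diagonals. -/
theorem segments_injOn (hN : N = a + 5) (hv : v.Valid a) (hw : w.Valid a)
    (h : v.segments a N = w.segments a N) : v = w := by
  have H : ∀ x y, v.Edge a x y ↔ w.Edge a x y := by
    intro x y
    by_cases hxy : x < N ∧ y < N
    · have := Finset.ext_iff.1 h (⟨x, hxy.1⟩, ⟨y, hxy.2⟩)
      simpa using this
    · have h1 := fun h => Edge.lt hv (x := x) (y := y) h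
      have h2 := fun h => Edge.lt hw (x := x) (y := y) h
      constructor <;> intro h <;> exfalso <;> grind
  rcases v with ⟨s, t, p, q⟩ | ⟨c, i, p, q⟩ <;> rcases w with ⟨s', t', p', q'⟩ | ⟨c', i', p', q'⟩ <;>
    simp only [Valid] at hv hw
  · have d1 := H s (a + 2)
    have d2 := H t (a + 2)
    have d3 := H s' (a + 2)
    have d4 := H t' (a + 2)
    rw [edge_fan_iff, edge_fan_iff] at d1 d2 d3 d4 <;> try omega
    obtain rfl : s = s' := by omega
    obtain rfl : t = t' := by omega
    have c2 := H a (a + 2)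
    have c6 := H (a + 2) (a + 4)
    cases p <;> cases q <;> cases p' <;> cases q' <;> simp [Edge] at * <;> omega
  · have d1 := H s (a + 2)
    rw [edge_fan_iff (by omega)] at d1
    exact (not_edge_hex (by omega) (d1.1 ⟨le_rfl, hv.1⟩)).elim
  · have d1 := H s' (a + 2)
    rw [edge_fan_iff (by omega)] at d1
    exact (not_edge_hex (by omega) (d1.2 ⟨le_rfl, hw.1⟩)).elim
  · have d1 := H i (a + 4)
    have d2 := H i' (a + 4)
    rw [edge_hex_iff (by omega), edge_hex_iff (by omega)] at d1 d2
    obtain rfl : i = i' := by omega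
    have c1 := H a (a + 2)
    have c2 := H a (a + 3)
    have c3 := H a (a + 4)
    have c4 := H (a + 1) (a + 3)
    have c5 := H (a + 1) (a + 4)
    have c6 := H (a + 2) (a + 4)
    clear d1 d2 H
    cases c <;> cases p <;> cases q <;> cases c' <;> cases p' <;> cases q' <;> simp [Edge] at * <;>
      omega

/-- The flips between colorful triangulations, oriented such that the new segment has the larger
end points. -/
def Step : Node → Node → Prop
  | fan s t p q, fan s' t' p' q' =>
    (s' = s ∧ t' = t ∧ p = true ∧ p' = false ∧ q' = q) ∨
    (s' = s ∧ t' = t ∧ p' = p ∧ q = true ∧ q' = false) ∨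
    (s' = s + 1 ∧ t' = t ∧ p = false ∧ p' = false ∧ q' = q) ∨
    (s' = s ∧ t' = t + 1 ∧ p' = p ∧ q = false ∧ q' = false)
  | fan s t p q, hex c i p' q' => s = i ∧ t = i ∧ p = c ∧ q = !c ∧ p' = true ∧ q' = false
  | hex c i p q, hex c' i' p' q' =>
    (c' = c ∧ i' = i ∧ p = true ∧ p' = false ∧ q' = q) ∨
    (c' = c ∧ i' = i ∧ p' = p ∧ q = !c ∧ q' = c) ∨
    (c' = c ∧ i' = i + 1 ∧ p = false ∧ p' = false ∧ q' = q) ∨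
    (c = true ∧ c' = false ∧ i' = i ∧ p = false ∧ p' = false ∧ q = true ∧ q' = true)
  | hex .., fan .. => False

theorem isFlip_segments (hN : N = a + 5) {i j k l : ℕ} (hij : i < j) (hjk : j < k)
    (hkl : k < l) (hl : l ≤ a + 4) (h1 : v.Edge a i j) (h2 : v.Edge a j k) (h3 : v.Edge a k l)
    (h4 : v.Edge a i l) (h5 : v.Edge a i k)
    (hw : ∀ x y, x < y → (w.Edge a x y ↔ (x = j ∧ y = l) ∨ (v.Edge a x y ∧ ¬ (x = i ∧ y = k))))
    (hv : v.Valid a) (hw' : w.Valid a) :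
    IsFlip (v.segments a N) (w.segments a N) := by
  refine ⟨⟨i, by omega⟩, ⟨j, by omega⟩, ⟨k, by omega⟩, ⟨l, by omega⟩, hij, hjk, hkl, by simpa,
    by simpa, by simpa, by simpa, Or.inl ⟨by simpa, ?_⟩⟩
  ext ⟨x, y⟩
  simp only [mem_segments, Finset.mem_insert, Finset.mem_erase, Prod.mk.injEq, Fin.ext_iff, ne_eq]
  by_cases hxy : (x : ℕ) < y
  · rw [hw _ _ hxy, and_comm (b := v.Edge a x y)]
  · have := fun h => Edge.lt hv (x := x) (y := y) h
    have := fun h => Edge.lt hw' (x := x) (y := y) h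
    grind

theorem Step.isFlip (hN : N = a + 5) (hv : v.Valid a) (hw : w.Valid a) (h : Step v w) :
    IsFlip (v.segments a N) (w.segments a N) := by
  rcases v with ⟨s, t, p, q⟩ | ⟨c, i, p, q⟩ <;> rcases w with ⟨s', t', p', q'⟩ | ⟨c', i', p', q'⟩
  · rcases h with ⟨rfl, rfl, rfl, rfl, rfl⟩ | ⟨rfl, rfl, rfl, rfl, rfl⟩ | ⟨rfl, rfl, rfl, rfl, rfl⟩ |
      ⟨rfl, rfl, rfl, rfl, rfl⟩
    · apply isFlip_segments hN (i := s') (j := a + 2) (k := a + 3) (l := a + 4) <;>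
        (simp only [Edge, Valid] at *; grind (splits := 25))
    · apply isFlip_segments hN (i := t') (j := a) (k := a + 1) (l := a + 2) <;>
        (simp only [Edge, Valid] at *; grind (splits := 25))
    · apply isFlip_segments hN (i := s) (j := s + 1) (k := a + 2) (l := a + 4) <;>
        (simp only [Edge, Valid] at *; grind (splits := 25))
    · apply isFlip_segments hN (i := t) (j := t + 1) (k := a) (l := a + 2) <;>
        (simp only [Edge, Valid] at *; grind (splits := 25))
  · obtain ⟨rfl, rfl, rfl, rfl, rfl, rfl⟩ := h
    cases p
    · apply isFlip_segments hN (i := t) (j := a + 1) (k := a + 2) (l := a + 4) <;>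
        (simp only [Edge, Valid] at *; grind (splits := 25))
    · apply isFlip_segments hN (i := t) (j := a) (k := a + 2) (l := a + 3) <;>
        (simp only [Edge, Valid] at *; grind (splits := 25))
  · exact h.elim
  · rcases h with ⟨rfl, rfl, rfl, rfl, rfl⟩ | ⟨rfl, rfl, rfl, rfl, rfl⟩ | ⟨rfl, rfl, rfl, rfl, rfl⟩ |
      ⟨rfl, rfl, rfl, rfl, rfl, rfl, rfl⟩
    · cases c'
      · apply isFlip_segments hN (i := i') (j := a) (k := a + 1) (l := a + 4) <;>
          (simp only [Edge, Valid] at *; grind (splits := 25))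
      · apply isFlip_segments hN (i := i') (j := a) (k := a + 3) (l := a + 4) <;>
          (simp only [Edge, Valid] at *; grind (splits := 25))
    · cases q'
      · apply isFlip_segments hN (i := a + 1) (j := a + 2) (k := a + 3) (l := a + 4) <;>
          (simp only [Edge, Valid] at *; grind (splits := 25))
      · apply isFlip_segments hN (i := a) (j := a + 1) (k := a + 2) (l := a + 3) <;>
          (simp only [Edge, Valid] at *; grind (splits := 25))
    · apply isFlip_segments hN (i := i) (j := i + 1) (k := a) (l := a + 4) <;>
        (simp only [Edge, Valid] at *; grind (splits := 25))
    · apply isFlip_segments hN (i := a) (j := a + 1) (k := a + 3) (l := a + 4) <;>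
        (simp only [Edge, Valid] at *; grind (splits := 25))

end Node

/-! ### A counting obstruction to Hamilton cycles -/

/-- If the neighbors of a nonempty set `A` lie in a set `B` that is disjoint from `A` and not larger
than it, and `A ∪ B` is not everything, then there is no Hamilton cycle. -/
theorem not_hasHamiltonCycle_of_neighbors_subset {V : Type*} [DecidableEq V] {G : SimpleGraph V}
    {A B : Set V} (hA : A.Nonempty) (hAB : ∀ x ∈ A, ∀ y, G.Adj x y → y ∈ B)
    {f : V → V} (hf : Set.MapsTo f B A) (hfi : Set.InjOn f B) {z : V} (hzA : z ∉ A) (hzB : z ∉ B) :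
    ¬ HasHamiltonCycle G := by
  classical
  rintro ⟨u, p, hp⟩
  have := hp.finite
  have := Fintype.ofFinite V
  set H := p.toSubgraph with hH
  have two : ∀ x, (Finset.univ.filter fun y => H.Adj x y).card = 2 := by
    intro x
    rw [← hp.isCycle.ncard_neighborSet_toSubgraph_eq_two (hp.mem_support x), ← Set.ncard_coe_finset]
    congr 1
    ext y
    simp [hH]
  have hcard : B.toFinset.card ≤ A.toFinset.card :=
    Finset.card_le_card_of_injOn f (by simpa using hf) (by simpa using hfi)
  have count := Finset.sum_card_bipartiteAbove_eq_sum_card_bipartiteBelow (s := A.toFinset)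
    (t := B.toFinset) H.Adj
  have hA2 : ∀ x ∈ A.toFinset, (B.toFinset.bipartiteAbove H.Adj x).card = 2 := by
    intro x hx
    rw [← two x]
    congr 1
    ext y
    simp only [Finset.mem_bipartiteAbove, Finset.mem_filter, Finset.mem_univ, true_and,
      Set.mem_toFinset, and_iff_right_iff_imp]
    exact fun h => hAB x (by simpa using hx) y h.adj_sub
  have hsub : ∀ y, A.toFinset.bipartiteBelow H.Adj y ⊆ Finset.univ.filter fun x => H.Adj y x := by
    intro y x hx
    simpa using ((Finset.mem_bipartiteBelow _).1 hx).2.symm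
  have hB2 : ∀ y ∈ B.toFinset, (A.toFinset.bipartiteBelow H.Adj y).card ≤ 2 := fun y _ =>
    (Finset.card_le_card (hsub y)).trans (two y).le
  rw [Finset.sum_congr rfl hA2] at count
  -- Counting cycle edges between the two sets gives `2|A|` from the side of `A` and at most `2|B| ≤
  -- 2|A|` from the side of `B`; equality must hold at every vertex of `B`.
  have hB : ∀ y ∈ B.toFinset, (A.toFinset.bipartiteBelow H.Adj y).card = 2 := by
    refine (Finset.sum_eq_sum_iff_of_le hB2).1 (le_antisymm (Finset.sum_le_sum hB2) ?_)
    rw [← count]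
    simp only [Finset.sum_const, smul_eq_mul]
    omega
  -- Hence both cycle edges at a vertex of `B` lead to `A`, and the connected cycle cannot leave `A
  -- ∪ B`.
  have closed : ∀ x y, x ∈ A ∪ B → H.Adj x y → y ∈ A ∪ B := by
    rintro x y (hx | hx) h
    · exact Or.inr (hAB x hx y h.adj_sub)
    · have := Finset.eq_of_subset_of_card_le (hsub x) (by rw [two, hB x (by simpa using hx)])
      have hy : y ∈ Finset.univ.filter fun w => H.Adj x w := by simpa using h
      rw [← this, Finset.mem_bipartiteBelow] at hy
      exact Or.inl (by simpa using hy.1)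
  obtain ⟨x, hx⟩ := hA
  have hverts : ∀ w, w ∈ H.verts := fun w => by
    rw [hH, SimpleGraph.Walk.mem_verts_toSubgraph]
    exact hp.mem_support w
  obtain ⟨q⟩ := p.toSubgraph_connected.preconnected ⟨x, hverts x⟩ ⟨z, hverts z⟩
  have walk : ∀ {v w : H.verts}, H.coe.Walk v w → v.1 ∈ A ∪ B → w.1 ∈ A ∪ B := by
    intro v w q
    induction q with
    | nil => exact id
    | cons h _ ih => exact fun hv => ih (closed _ _ hv h)
  rcases walk q (Or.inl hx) with h | h
  · exact hzA h
  · exact hzB h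

/-! ### Parity of fans -/

namespace Node

/-- The parity class of a triangulation in which `a + 2` is joined to one of `0, …, a - 1`. -/
def FanParity (r : ℕ) : Node → Prop
  | fan s t p q => (s + t + p.toNat + q.toNat) % 2 = r
  | hex .. => False

/-- Flips the diagonal of the first of the two free quadrilaterals. -/
def toggle : Node → Node
  | fan s t p q => fan s t (!p) q
  | hex c i p q => hex c i (!p) q

theorem toggle_toggle (v : Node) : v.toggle.toggle = v := by
  cases v <;> simp [toggle]

theorem Valid.toggle {a : ℕ} {v : Node} (h : v.Valid a) : v.toggle.Valid a := by
  cases v <;> exact h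

theorem FanParity.toggle {v : Node} (h : v.FanParity 1) : v.toggle.FanParity 0 := by
  rcases v with ⟨s, t, p, q⟩ | _
  · cases p <;> simp [Node.toggle, FanParity] at * <;> omega
  · exact h

variable {a N : ℕ} {v w : Node}

/-- For the parity argument it is enough that a flip loses at most one segment; this avoids showing
that `Step` lists all flips. -/
theorem _root_.IsFlip.exists_subset_insert {T T' : Finset (Fin N × Fin N)}
    (h : IsFlip T T' ∨ IsFlip T' T) : ∃ e, T ⊆ insert e T' := by
  rcases h with ⟨i, j, k, l, -, -, -, -, -, -, -, ⟨-, h⟩ | ⟨-, h⟩⟩ |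
    ⟨i, j, k, l, -, -, -, -, -, -, -, ⟨-, h⟩ | ⟨-, h⟩⟩
  · exact ⟨(i, k), by rw [h]; intro e; simp; tauto⟩
  · exact ⟨(j, l), by rw [h]; intro e; simp; tauto⟩
  · exact ⟨(j, l), by rw [h]; exact Finset.insert_subset_insert _ (Finset.erase_subset _ _)⟩
  · exact ⟨(i, k), by rw [h]; exact Finset.insert_subset_insert _ (Finset.erase_subset _ _)⟩

theorem edge_fan_last_iff {s t x : ℕ} {p q : Bool} (hx : x < a) :
    (fan s t p q).Edge a x (a + 4) ↔ x ≤ s := by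
  simp only [Edge]
  grind

theorem edge_fan_first_iff {s t x : ℕ} {p q : Bool} :
    (fan s t p q).Edge a x a ↔ (t ≤ x ∧ x < a) ∨ x + 1 = a := by
  simp only [Edge]
  grind

theorem edge_fan_red_iff {s t x : ℕ} {p q : Bool} (hx : x < a) :
    ((fan s t p q).Edge a x (a + 3) ↔ p = true ∧ x = s) ∧
      ((fan s t p q).Edge a x (a + 1) ↔ q = true ∧ x = t) := by
  simp only [Edge]
  grind

theorem edge_fan_blue_iff {s t : ℕ} {p q : Bool} (hs : s < a) (ht : t < a) :
    ((fan s t p q).Edge a (a + 2) (a + 4) ↔ p = false) ∧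
      ((fan s t p q).Edge a a (a + 2) ↔ q = false) := by
  simp only [Edge]
  grind

/-- Changing two coordinates of a fan would lose at least two segments, and moving `s` or `t` by
more than one does so too. -/
theorem FanParity.of_edge_imp (hv : v.Valid a) (hw : w.Valid a) (hvw : v ≠ w) {x₀ y₀ : ℕ}
    (h : ∀ x y, v.Edge a x y → ¬ (x = x₀ ∧ y = y₀) → w.Edge a x y) (hp : v.FanParity 0) :
    w.FanParity 1 := by
  rcases v with ⟨s, t, p, q⟩ | _
  swap
  · exact hp.elim
  obtain ⟨hst, ht⟩ := hv
  rcases w with ⟨s', t', p', q'⟩ | ⟨c', i', p', q'⟩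
  · obtain ⟨hst', ht'⟩ := hw
    have e1 := h s (a + 4)
    -- For `s = 0` the truncated subtraction merely repeats `e1`.
    have e2 := h (s - 1) (a + 4)
    have e3 := h s (a + 2)
    have e5 := h t (a + 2)
    have e7 := h t a
    have e9 := h s (a + 3)
    have e10 := h (a + 2) (a + 4)
    have e11 := h t (a + 1)
    have e12 := h a (a + 2)
    have e4 : s < t → _ := fun _ => h (s + 1) (a + 2)
    have e6 : s < t → _ := fun _ => h (t - 1) (a + 2)
    have e8 := h (t + 1) a
    have hs1 : s - 1 < a := by omega
    have hs : s < a := by omega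
    have hs' : s' < a := by omega
    rw [edge_fan_last_iff hs, edge_fan_last_iff hs] at e1
    rw [edge_fan_last_iff hs1, edge_fan_last_iff hs1] at e2
    rw [edge_fan_iff hs, edge_fan_iff hs] at e3
    rw [edge_fan_iff ht, edge_fan_iff ht] at e5
    rw [edge_fan_first_iff, edge_fan_first_iff] at e7 e8
    rw [(edge_fan_red_iff hs).1, (edge_fan_red_iff hs).1] at e9
    rw [(edge_fan_red_iff ht).2, (edge_fan_red_iff ht).2] at e11
    rw [(edge_fan_blue_iff hs ht).1, (edge_fan_blue_iff hs' ht').1] at e10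
    rw [(edge_fan_blue_iff hs ht).2, (edge_fan_blue_iff hs' ht').2] at e12
    replace e4 : s < t → _ := fun hlt => by
      have := e4 hlt
      rwa [edge_fan_iff (by omega), edge_fan_iff (by omega)] at this
    replace e6 : s < t → _ := fun hlt => by
      have := e6 hlt
      rwa [edge_fan_iff (by omega), edge_fan_iff (by omega)] at this
    -- Each direction in which `s` or `t` can move already costs a specific segment, which must then
    -- be the lost one.
    have hs2 : s < s' → x₀ = s ∧ y₀ = a + 2 := by clear e9 e10 e11 e12 e8 hvw; omega
    have hs3 : s' < s → x₀ = s ∧ y₀ = a + 4 := by clear e9 e10 e11 e12 e8 hvw; omega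
    have ht2 : t < t' → x₀ = t ∧ y₀ = a := by clear e9 e10 e11 e12 e8 hvw; omega
    have ht3 : t' < t → x₀ = t ∧ y₀ = a + 2 := by clear e9 e10 e11 e12 e8 hvw; omega
    have hs4 : s' ≤ s + 1 := by clear e9 e10 e11 e12 hvw; omega
    have hs5 : s ≤ s' + 1 := by clear e9 e10 e11 e12 hvw; omega
    have ht4 : t' ≤ t + 1 := by clear e9 e10 e11 e12 hvw; omega
    have ht5 : t ≤ t' + 1 := by clear e9 e10 e11 e12 hvw; omega
    have hst2 : s = s' ∨ t = t' := by clear e9 e10 e11 e12 e8 hvw; omega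
    clear e1 e2 e3 e4 e5 e6 e7 e8 h
    simp only [ne_eq, fan.injEq] at hvw
    simp only [FanParity] at hp ⊢
    cases p <;> cases q <;> cases p' <;> cases q' <;>
      simp only [Bool.toNat_true, Bool.toNat_false, true_and, and_true, false_and, and_false,
        reduceCtorEq, false_imp_iff, true_imp_iff, imp_false, not_not] at * <;> omega
  · have e1 := h s (a + 2)
    have e2 := h t (a + 2)
    have e3 := h s (a + 3)
    have e4 := h (a + 2) (a + 4)
    have e5 := h t (a + 1)
    have e6 := h a (a + 2)
    have hs : s < a := by omega
    have n1 := not_edge_hex (c := c') (i := i') (p := p') (q := q') hs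
    have n2 := not_edge_hex (c := c') (i := i') (p := p') (q := q') ht
    rw [edge_fan_iff hs] at e1
    rw [edge_fan_iff ht] at e2
    rw [(edge_fan_red_iff hs).1] at e3
    rw [(edge_fan_red_iff ht).2] at e5
    rw [(edge_fan_blue_iff hs ht).1] at e4
    rw [(edge_fan_blue_iff hs ht).2] at e6
    obtain rfl : s = t := by
      by_contra hne
      have c1 : s = x₀ ∧ a + 2 = y₀ := by
        by_contra hc
        exact n1 (e1 (by omega) hc)
      have c2 : t = x₀ ∧ a + 2 = y₀ := by
        by_contra hc
        exact n2 (e2 (by omega) hc)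
      omega
    obtain ⟨rfl, rfl⟩ : s = x₀ ∧ a + 2 = y₀ := by
      by_contra hc
      exact n1 (e1 (by omega) hc)
    -- With `s = t`, even parity means `p = q`. The two remaining diagonals of the fan would then
    -- require opposite values of `c'`, so they cannot both survive.
    simp only [FanParity] at hp
    simp only [Valid] at hw
    cases p <;> cases q <;> cases c' <;> simp [Edge] at e3 e4 e5 e6 hp <;> omega

end Node

/-! ### Transfer to the graph and absence of Hamilton cycles -/

theorem sum_pattern (a : ℕ) : [a, 1, 1, 1, 1, 1].sum = a + 5 := by
  simp

theorem pointColor_eq_true_iff (a : ℕ) (i : Fin [a, 1, 1, 1, 1, 1].sum) :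
    pointColor [a, 1, 1, 1, 1, 1] i = true ↔ Node.Red a i := by
  have hi : (i : ℕ) < a + 5 := i.2.trans_eq (sum_pattern a)
  have hl : colorPattern true [a, 1, 1, 1, 1, 1] =
      List.replicate a true ++ [false, true, false, true, false] := by
    simp [colorPattern]
  simp only [pointColor, List.get_eq_getElem, Fin.val_cast, Node.Red]
  simp only [hl]
  rcases lt_or_ge (i : ℕ) a with h | h
  · simp [List.getElem_append_left, h]
  · obtain ⟨k, hk⟩ := Nat.exists_eq_add_of_le h
    rw [List.getElem_append_right (by simpa using h)]
    simp only [List.length_replicate, hk, Nat.add_sub_cancel_left]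
    have hk5 : k < 5 := by omega
    interval_cases k <;> simp

namespace Node

variable {a : ℕ}

/-- The vertex of `ℱ_(a, 1, 1, 1, 1, 1)` with the given coordinates. -/
def toVertex (a : ℕ) (v : {v : Node // v.Valid a}) :
    {T : Triangulation [a, 1, 1, 1, 1, 1].sum |
      IsColorful (pointColor [a, 1, 1, 1, 1, 1]) T.1} :=
  ⟨⟨v.1.segments a _, isTriangulation_segments (sum_pattern a) v.2⟩,
    isColorful_segments (pointColor_eq_true_iff a) v.2⟩

theorem toVertex_bijective (ha : 1 ≤ a) : Function.Bijective (toVertex a) := by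
  constructor
  · intro v w h
    exact Subtype.ext (segments_injOn (sum_pattern a) v.2 w.2
      (congrArg Subtype.val (congrArg Subtype.val h)))
  · rintro ⟨⟨T, hT⟩, hc⟩
    obtain ⟨v, hv, rfl⟩ := exists_eq_segments (sum_pattern a) ha (pointColor_eq_true_iff a) hT hc
    exact ⟨⟨v, hv⟩, rfl⟩

theorem adj_toVertex_iff {v w : {v : Node // v.Valid a}} :
    (colorfulFlipGraph [a, 1, 1, 1, 1, 1]).Adj (toVertex a v) (toVertex a w) ↔
      v ≠ w ∧ (IsFlip (v.1.segments a [a, 1, 1, 1, 1, 1].sum) (w.1.segments a _) ∨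
        IsFlip (w.1.segments a [a, 1, 1, 1, 1, 1].sum) (v.1.segments a _)) := by
  have hne : v ≠ w ↔ (toVertex a v).1 ≠ (toVertex a w).1 := by
    rw [ne_eq, ne_eq, not_iff_not]
    refine ⟨fun h => h ▸ rfl, fun h => ?_⟩
    exact Subtype.ext (segments_injOn (sum_pattern a) v.2 w.2 (congrArg Subtype.val h))
  rw [hne]
  exact SimpleGraph.fromRel_adj (fun T T' : Triangulation _ => IsFlip T.1 T'.1) (toVertex a v).1
    (toVertex a w).1

theorem Step.ne {v w : Node} (h : Step v w) : v ≠ w := by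
  rintro rfl
  rcases v with ⟨s, t, p, q⟩ | ⟨c, i, p, q⟩ <;> simp [Step] at h
  cases c <;> simp at h

theorem Step.adj_toVertex {v w : {v : Node // v.Valid a}} (h : Step v.1 w.1) :
    (colorfulFlipGraph [a, 1, 1, 1, 1, 1]).Adj (toVertex a v) (toVertex a w) :=
  adj_toVertex_iff.2 ⟨fun hvw => h.ne (congrArg Subtype.val hvw),
    Or.inl (h.isFlip (sum_pattern a) v.2 w.2)⟩

theorem FanParity.of_adj {v w : {v : Node // v.Valid a}} (hv : v.1.FanParity 0)
    (h : (colorfulFlipGraph [a, 1, 1, 1, 1, 1]).Adj (toVertex a v) (toVertex a w)) :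
    w.1.FanParity 1 := by
  obtain ⟨hne, h⟩ := adj_toVertex_iff.1 h
  obtain ⟨e, he⟩ := IsFlip.exists_subset_insert h
  refine FanParity.of_edge_imp v.2 w.2 (fun h => hne (Subtype.ext h)) (x₀ := e.1) (y₀ := e.2) ?_ hv
  intro x y hxy hxe
  have hlt := Edge.lt v.2 hxy
  have hN := sum_pattern a
  have := he (mem_segments.2 hxy : (⟨x, by omega⟩, ⟨y, by omega⟩) ∈ _)
  rw [Finset.mem_insert, mem_segments] at this
  refine this.resolve_left fun h => hxe ?_
  rw [← h]
  exact ⟨rfl, rfl⟩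

end Node

theorem not_hasHamiltonCycle_colorfulFlipGraph {a : ℕ} (ha : 1 ≤ a) :
    ¬ HasHamiltonCycle (colorfulFlipGraph [a, 1, 1, 1, 1, 1]) := by
  obtain ⟨e, he⟩ : ∃ e : {v : Node // v.Valid a} ≃ _, ∀ v, e v = Node.toVertex a v :=
    ⟨Equiv.ofBijective _ (Node.toVertex_bijective ha), fun _ => rfl⟩
  refine not_hasHamiltonCycle_of_neighbors_subset
    (A := {x | (e.symm x).1.FanParity 0}) (B := {x | (e.symm x).1.FanParity 1})
    (f := fun x => e ⟨(e.symm x).1.toggle, (e.symm x).2.toggle⟩)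
    (z := e ⟨.hex false 0 false false, ha⟩) ?_ ?_ ?_ ?_ ?_ ?_
  · exact ⟨e ⟨.fan 0 0 false false, le_rfl, ha⟩, by
      change (e.symm (e _)).1.FanParity 0
      rw [Equiv.symm_apply_apply]
      simp [Node.FanParity]⟩
  · intro x hx y hxy
    obtain ⟨v, rfl⟩ := e.surjective x
    obtain ⟨w, rfl⟩ := e.surjective y
    rw [he, he] at hxy
    change (e.symm (e _)).1.FanParity _ at hx
    change (e.symm (e _)).1.FanParity _
    rw [Equiv.symm_apply_apply] at hx ⊢
    exact hx.of_adj hxy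
  · intro x hx
    change (e.symm (e _)).1.FanParity _
    rw [Equiv.symm_apply_apply]
    exact Node.FanParity.toggle hx
  · intro x _ y _ hxy
    have := congrArg Node.toggle (congrArg Subtype.val (e.injective hxy))
    simp only [Node.toggle_toggle] at this
    exact e.symm.injective (Subtype.ext this)
  · change ¬ (e.symm (e _)).1.FanParity _
    rw [Equiv.symm_apply_apply]
    simp [Node.FanParity]
  · change ¬ (e.symm (e _)).1.FanParity _
    rw [Equiv.symm_apply_apply]
    simp [Node.FanParity]

/-! ### Spanning paths in coordinates -/

/-- There is a path with steps in `r` from `x` to `y` that visits precisely the elements satisfying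
`S`, each of them once. -/
def HasSpanningPath {α : Type*} (r : α → α → Prop) (S : α → Prop) (x y : α) : Prop :=
  ∃ l : List α, l.IsChain r ∧ l.head? = some x ∧ l.getLast? = some y ∧ l.Nodup ∧ ∀ v, v ∈ l ↔ S v

namespace HasSpanningPath

variable {α : Type*} {r : α → α → Prop} {S S' T : α → Prop} {x y z w : α}

theorem append (h : HasSpanningPath r S x y) (hyz : r y z) (h' : HasSpanningPath r S' z w)
    (hd : ∀ v, S v → ¬ S' v) (hT : ∀ v, T v ↔ S v ∨ S' v) : HasSpanningPath r T x w := by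
  obtain ⟨l, hc, hx, hy, hn, hl⟩ := h
  obtain ⟨l', hc', hz, hw, hn', hl'⟩ := h'
  refine ⟨l ++ l', ?_, ?_, ?_, ?_, ?_⟩
  · refine hc.append hc' fun u hu v hv => ?_
    rw [hy, Option.mem_some_iff] at hu
    rw [hz, Option.mem_some_iff] at hv
    exact hu ▸ hv ▸ hyz
  · rw [List.head?_append, hx, Option.some_or]
  · rw [List.getLast?_append, hw, Option.some_or]
  · exact hn.append hn' fun v hv hv' => hd v ((hl v).1 hv) ((hl' v).1 hv')
  · intro v
    rw [List.mem_append, hl, hl', hT]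

theorem symm (hr : ∀ u v, r u v → r v u) (h : HasSpanningPath r S x y) :
    HasSpanningPath r S y x := by
  obtain ⟨l, hc, hx, hy, hn, hl⟩ := h
  refine ⟨l.reverse, ?_, ?_, ?_, List.nodup_reverse.2 hn, ?_⟩
  · rw [List.isChain_reverse]
    exact hc.imp fun u v huv => hr u v huv
  · rw [List.head?_reverse, hy]
  · rw [List.getLast?_reverse, hx]
  · simpa using hl

end HasSpanningPath

namespace Node

/-- Adjacency of coordinates under flips. -/
def Nbr (v w : Node) : Prop := Step v w ∨ Step w v

theorem Nbr.symm {v w : Node} (h : Nbr v w) : Nbr w v := Or.symm h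

/-- The coordinates `fan s t p q` with `C s t` and `hex c i p q` with `D c i`. -/
def Region (C : ℕ → ℕ → Prop) (D : Bool → ℕ → Prop) : Node → Prop
  | fan s t _ _ => C s t
  | hex c i _ _ => D c i

/-- Two adjacent columns of the staircase are swept by going out along column `t` and back along
column `t + 1`. Each induction step peels off two rows, since crossing one 4-cycle changes `q` and a
second one restores it; the base case is the tip of five cells. -/
theorem hasSpanningPath_fan_columns (k s t : ℕ) (ht : t = s + 2 * k + 1) :
    HasSpanningPath Nbr
      (Region (fun i j => s ≤ i ∧ i ≤ j ∧ (j = t ∨ j = t + 1)) fun _ _ => False)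
      (.fan s t false false) (.fan s (t + 1) false false) := by
  induction k generalizing s with
  | zero =>
    subst ht
    refine ⟨[.fan s (s + 1) false false, .fan (s + 1) (s + 1) false false, .fan (s + 1) (s + 2) false
      false, .fan (s + 2) (s + 2) false false, .fan (s + 2) (s + 2) true false, .fan (s + 2) (s
      + 2) true true, .fan (s + 2) (s + 2) false true, .fan (s + 1) (s + 2) false true, .fan (s
      + 1) (s + 2) true true, .fan (s + 1) (s + 2) true false, .fan (s + 1) (s + 1) true false,
      .fan (s + 1) (s + 1) true true, .fan (s + 1) (s + 1) false true, .fan s (s + 1) false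
      true, .fan s (s + 1) true true, .fan s (s + 1) true false, .fan s (s + 2) true false, .fan
      s (s + 2) true true, .fan s (s + 2) false true, .fan s (s + 2) false false], ?_, rfl, rfl, ?_, ?_⟩
    · simp [Nbr, Step]
    · simp
    · rintro (⟨i, j, p, q⟩ | ⟨c, i, p, q⟩)
      · cases p <;> cases q <;> simp [Region] <;> omega
      · simp [Region]
  | succ k ih =>
    have h1 : HasSpanningPath Nbr (Region (fun i j => (i = s ∨ i = s + 1) ∧ j = t) fun _ _ => False)
        (.fan s t false false) (.fan (s + 1) t false false) := by
      refine ⟨[.fan s t false false, .fan s t true false, .fan s t true true, .fan s t false true, .fan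
      (s + 1) t false true, .fan (s + 1) t true true, .fan (s + 1) t true false, .fan (s + 1) t
      false false], ?_, rfl, rfl, ?_, ?_⟩
      · simp [Nbr, Step]
      · simp
      · rintro (⟨i, j, p, q⟩ | ⟨c, i, p, q⟩)
        · cases p <;> cases q <;> simp [Region] <;> omega
        · simp [Region]
    have h2 : HasSpanningPath Nbr
        (Region (fun i j => (i = s ∨ i = s + 1) ∧ j = t + 1) fun _ _ => False)
        (.fan (s + 1) (t + 1) false false) (.fan s (t + 1) false false) := by
      refine ⟨[.fan (s + 1) (t + 1) false false, .fan (s + 1) (t + 1) true false, .fan (s + 1) (t + 1)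
      true true, .fan (s + 1) (t + 1) false true, .fan s (t + 1) false true, .fan s (t + 1) true
      true, .fan s (t + 1) true false, .fan s (t + 1) false false], ?_, rfl, rfl, ?_, ?_⟩
      · simp [Nbr, Step]
      · simp
      · rintro (⟨i, j, p, q⟩ | ⟨c, i, p, q⟩)
        · cases p <;> cases q <;> simp [Region] <;> omega
        · simp [Region]
    have h3 := h1.append (by simp [Nbr, Step]) (ih (s + 2) (by omega))
      (T := Region (fun i j => s ≤ i ∧ i ≤ j ∧ (j = t ∨ (j = t + 1 ∧ s + 2 ≤ i))) fun _ _ => False) ?_ ?_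
    · refine h3.append (by simp [Nbr, Step]) h2 ?_ ?_
      · rintro (_ | _) <;> simp [Region]; omega
      · rintro (_ | _) <;> simp [Region]; omega
    · rintro (_ | _) <;> simp [Region]; omega
    · rintro (_ | _) <;> simp [Region]; omega

/-- The start is the fan at which the hex part is attached. Two new columns are added by treating
row `0` separately, so that the rest has the shape required by `hasSpanningPath_fan_columns`. -/
theorem hasSpanningPath_fan_even (k : ℕ) :
    HasSpanningPath Nbr (Region (fun i j => i ≤ j ∧ j < 2 * k + 2) fun _ _ => False)
      (.fan 0 0 true false) (.fan 0 (2 * k + 1) true false) := by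
  induction k with
  | zero =>
    refine ⟨[.fan 0 0 true false, .fan 0 0 true true, .fan 0 0 false true, .fan 0 0 false false, .fan 0
      1 false false, .fan 1 1 false false, .fan 1 1 true false, .fan 1 1 true true, .fan 1 1
      false true, .fan 0 1 false true, .fan 0 1 true true, .fan 0 1 true false], ?_, rfl, rfl, ?_, ?_⟩
    · simp [Nbr, Step]
    · simp
    · rintro (⟨i, j, p, q⟩ | ⟨c, i, p, q⟩)
      · cases p <;> cases q <;> simp [Region] <;> omega
      · simp [Region]
  | succ k ih =>
    have h1 : HasSpanningPath Nbr (Region (fun i j => i = 0 ∧ j = 2 * k + 2) fun _ _ => False)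
        (.fan 0 (2 * k + 2) true false) (.fan 0 (2 * k + 2) false false) := by
      refine ⟨[.fan 0 (2 * k + 2) true false, .fan 0 (2 * k + 2) true true, .fan 0 (2 * k + 2) false
      true, .fan 0 (2 * k + 2) false false], ?_, rfl, rfl, ?_, ?_⟩
      · simp [Nbr, Step]
      · simp
      · rintro (⟨i, j, p, q⟩ | ⟨c, i, p, q⟩)
        · cases p <;> cases q <;> simp [Region]
        · simp [Region]
    have h2 : HasSpanningPath Nbr (Region (fun i j => i = 0 ∧ j = 2 * k + 3) fun _ _ => False)
        (.fan 0 (2 * k + 3) false false) (.fan 0 (2 * k + 3) true false) := by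
      refine ⟨[.fan 0 (2 * k + 3) false false, .fan 0 (2 * k + 3) false true, .fan 0 (2 * k + 3) true
      true, .fan 0 (2 * k + 3) true false], ?_, rfl, rfl, ?_, ?_⟩
      · simp [Nbr, Step]
      · simp
      · rintro (⟨i, j, p, q⟩ | ⟨c, i, p, q⟩)
        · cases p <;> cases q <;> simp [Region]
        · simp [Region]
    have h3 := ih.append (by simp [Nbr, Step]) h1
      (T := Region (fun i j => i ≤ j ∧ (j < 2 * k + 2 ∨ (i = 0 ∧ j = 2 * k + 2))) fun _ _ => False) ?_ ?_
    · have h4 := h3.append (by simp [Nbr, Step])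
        (hasSpanningPath_fan_columns k 1 (2 * k + 2) (by omega))
        (T := Region (fun i j => i ≤ j ∧ (j < 2 * k + 3 ∨ (1 ≤ i ∧ j = 2 * k + 3))) fun _ _ => False)
        ?_ ?_
      · refine h4.append (by simp [Nbr, Step]) h2 ?_ ?_
        · rintro (_ | _) <;> simp [Region]; omega
        · rintro (_ | _) <;> simp [Region]; omega
      · rintro (_ | _) <;> simp [Region]; omega
      · rintro (_ | _) <;> simp [Region]; omega
    · rintro (_ | _) <;> simp [Region]; omega
    · rintro (_ | _) <;> simp [Region]; omega

/-- A path through the coordinates `fan s t p q` with `t < 5`. -/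
def fanPathFive : List Node :=
  [.fan 1 1 true false, .fan 1 1 true true, .fan 1 1 false true, .fan 0 1 false true, .fan 0 1
   true true, .fan 0 1 true false, .fan 0 0 true false, .fan 0 0 true true, .fan 0 0 false
   true, .fan 0 0 false false, .fan 0 1 false false, .fan 1 1 false false, .fan 1 2 false
   false, .fan 2 2 false false, .fan 2 2 true false, .fan 2 2 true true, .fan 2 2 false true,
   .fan 1 2 false true, .fan 1 2 true true, .fan 1 2 true false, .fan 1 3 true false, .fan 1 3
   true true, .fan 1 3 false true, .fan 0 3 false true, .fan 0 3 true true, .fan 0 3 true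
   false, .fan 0 2 true false, .fan 0 2 true true, .fan 0 2 false true, .fan 0 2 false false,
   .fan 0 3 false false, .fan 1 3 false false, .fan 2 3 false false, .fan 3 3 false false, .fan
   3 4 false false, .fan 4 4 false false, .fan 4 4 true false, .fan 4 4 true true, .fan 4 4
   false true, .fan 3 4 false true, .fan 3 4 true true, .fan 3 4 true false, .fan 3 3 true
   false, .fan 3 3 true true, .fan 3 3 false true, .fan 2 3 false true, .fan 2 3 true true,
   .fan 2 3 true false, .fan 2 4 true false, .fan 2 4 true true, .fan 2 4 false true, .fan 2 4
   false false, .fan 1 4 false false, .fan 1 4 true false, .fan 1 4 true true, .fan 1 4 false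
   true, .fan 0 4 false true, .fan 0 4 true true, .fan 0 4 true false, .fan 0 4 false false]

/-- The induction starts from an explicit path through all 60 fans for `a = 5`; each further pair of
columns is a single application of `hasSpanningPath_fan_columns`. -/
theorem hasSpanningPath_fan_odd (k : ℕ) :
    HasSpanningPath Nbr (Region (fun i j => i ≤ j ∧ j < 2 * k + 5) fun _ _ => False)
      (.fan 1 1 true false) (.fan 0 (2 * k + 4) false false) := by
  induction k with
  | zero =>
    refine ⟨fanPathFive, ?_, rfl, rfl, by decide, ?_⟩
    · simp [fanPathFive, Nbr, Step]
    · have h1 : ∀ i < 5, ∀ j < 5, ∀ p q : Bool, i ≤ j → fan i j p q ∈ fanPathFive := by decide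
      have h2 : ∀ v ∈ fanPathFive, Region (fun i j => i ≤ j ∧ j < 2 * 0 + 5) (fun _ _ => False) v := by
        simp [fanPathFive, Region]
      rintro (⟨i, j, p, q⟩ | ⟨c, i, p, q⟩)
      · exact ⟨h2 _, fun h => h1 i (h.1.trans_lt h.2) j h.2 p q h.1⟩
      · exact ⟨h2 _, False.elim⟩
  | succ k ih =>
    refine ih.append (by simp [Nbr, Step])
      (hasSpanningPath_fan_columns (k + 2) 0 (2 * k + 5) (by omega)) ?_ ?_
    · rintro (_ | _) <;> simp [Region]; omega
    · rintro (_ | _) <;> simp [Region]; omega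

/-- The path runs out with `c` true and returns with `c` false. Passing a 4-cycle switches `q`, so
an odd number of columns lets the last one be left at `q` true, where `c` can change. -/
theorem hasSpanningPath_hex (k i : ℕ) :
    HasSpanningPath Nbr (Region (fun _ _ => False) fun _ j => i ≤ j ∧ j ≤ i + 2 * k)
      (.hex true i false false) (.hex false i false false) := by
  induction k generalizing i with
  | zero =>
    refine ⟨[.hex true i false false, .hex true i true false, .hex true i true true, .hex true i false
      true, .hex false i false true, .hex false i true true, .hex false i true false, .hex false
      i false false], ?_, rfl, rfl, ?_, ?_⟩
    · simp [Nbr, Step]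
    · simp
    · rintro (⟨i, j, p, q⟩ | ⟨c, i, p, q⟩)
      · simp [Region]
      · cases c <;> cases p <;> cases q <;> simp [Region] <;> omega
  | succ k ih =>
    have h1 : HasSpanningPath Nbr
        (Region (fun _ _ => False) fun c j => c = true ∧ (j = i ∨ j = i + 1))
        (.hex true i false false) (.hex true (i + 1) false false) := by
      refine ⟨[.hex true i false false, .hex true i true false, .hex true i true true, .hex true i false
      true, .hex true (i + 1) false true, .hex true (i + 1) true true, .hex true (i + 1) true
      false, .hex true (i + 1) false false], ?_, rfl, rfl, ?_, ?_⟩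
      · simp [Nbr, Step]
      · simp
      · rintro (⟨i, j, p, q⟩ | ⟨c, i, p, q⟩)
        · simp [Region]
        · cases c <;> cases p <;> cases q <;> simp [Region]
    have h2 : HasSpanningPath Nbr
        (Region (fun _ _ => False) fun c j => c = false ∧ (j = i ∨ j = i + 1))
        (.hex false (i + 1) false false) (.hex false i false false) := by
      refine ⟨[.hex false (i + 1) false false, .hex false (i + 1) true false, .hex false (i + 1) true
      true, .hex false (i + 1) false true, .hex false i false true, .hex false i true true, .hex
      false i true false, .hex false i false false], ?_, rfl, rfl, ?_, ?_⟩
      · simp [Nbr, Step]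
      · simp
      · rintro (⟨i, j, p, q⟩ | ⟨c, i, p, q⟩)
        · simp [Region]
        · cases c <;> cases p <;> cases q <;> simp [Region] <;> omega
    have h3 := h1.append (by simp [Nbr, Step]) (ih (i + 2))
      (T := Region (fun _ _ => False) fun c j =>
        i ≤ j ∧ j ≤ i + 2 * (k + 1) ∧ (c = true ∨ i + 2 ≤ j)) ?_ ?_
    · refine h3.append (by simp [Nbr, Step]) h2 ?_ ?_
      · rintro (_ | ⟨_ | _, _, _, _⟩) <;> simp [Region]
        omega
      · rintro (_ | ⟨_ | _, _, _, _⟩) <;> simp [Region]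
        omega
    · rintro (_ | ⟨_ | _, _, _, _⟩) <;> simp [Region]
      omega
    · rintro (_ | ⟨_ | _, _, _, _⟩) <;> simp [Region] <;> omega

end Node

namespace Node

theorem exists_hasSpanningPath_hex_even (k : ℕ) : ∃ x, HasSpanningPath Nbr
    (Region (fun _ _ => False) fun _ j => j < 2 * k + 2) (.hex true 0 true false) x := by
  have h1 : HasSpanningPath Nbr (Region (fun _ _ => False) fun c j => c = true ∧ j = 0)
      (.hex true 0 true false) (.hex true 0 false false) := by
    refine ⟨[.hex true 0 true false, .hex true 0 true true, .hex true 0 false true,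
      .hex true 0 false false], ?_, rfl, rfl, ?_, ?_⟩
    · simp [Nbr, Step]
    · simp
    · rintro (⟨i, j, p, q⟩ | ⟨c, i, p, q⟩)
      · simp [Region]
      · cases c <;> cases p <;> cases q <;> simp [Region]
  have h2 : HasSpanningPath Nbr (Region (fun _ _ => False) fun c j => c = false ∧ j = 0)
      (.hex false 0 false false) (.hex false 0 false true) := by
    refine ⟨[.hex false 0 false false, .hex false 0 true false, .hex false 0 true true,
      .hex false 0 false true], ?_, rfl, rfl, ?_, ?_⟩
    · simp [Nbr, Step]
    · simp
    · rintro (⟨i, j, p, q⟩ | ⟨c, i, p, q⟩)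
      · simp [Region]
      · cases c <;> cases p <;> cases q <;> simp [Region]
  have h3 := h1.append (by simp [Nbr, Step]) (hasSpanningPath_hex k 1)
    (T := Region (fun _ _ => False) fun c j => j < 2 * k + 2 ∧ (c = true ∨ 1 ≤ j)) ?_ ?_
  · refine ⟨_, h3.append (by simp [Nbr, Step]) h2 ?_ ?_⟩
    · rintro (_ | ⟨_ | _, _, _, _⟩) <;> simp [Region]
      omega
    · rintro (_ | ⟨_ | _, _, _, _⟩) <;> simp [Region]
      omega
  · rintro (_ | ⟨_ | _, _, _, _⟩) <;> simp [Region]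
    omega
  · rintro (_ | ⟨_ | _, _, _, _⟩) <;> simp [Region] <;> omega

/-- Columns `0` and `1` are detached: the path must start in column `1`, next to `fan 1 1 true
false`, and an odd number of columns remains. -/
theorem exists_hasSpanningPath_hex_odd (k : ℕ) : ∃ x, HasSpanningPath Nbr
    (Region (fun _ _ => False) fun _ j => j < 2 * k + 3) (.hex true 1 true false) x := by
  have h1 : HasSpanningPath Nbr (Region (fun _ _ => False) fun c j => c = true ∧ (j = 0 ∨ j = 1))
      (.hex true 1 true false) (.hex true 1 false false) := by
    refine ⟨[.hex true 1 true false, .hex true 1 true true, .hex true 1 false true,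
      .hex true 0 false true, .hex true 0 true true, .hex true 0 true false,
      .hex true 0 false false, .hex true 1 false false], ?_, rfl, rfl, ?_, ?_⟩
    · simp [Nbr, Step]
    · simp
    · rintro (⟨i, j, p, q⟩ | ⟨c, i, p, q⟩)
      · simp [Region]
      · cases c <;> cases p <;> cases q <;> simp [Region] <;> omega
  have h2 : HasSpanningPath Nbr (Region (fun _ _ => False) fun c j => c = false ∧ (j = 0 ∨ j = 1))
      (.hex false 1 false false) (.hex false 0 false false) := by
    refine ⟨[.hex false 1 false false, .hex false 1 true false, .hex false 1 true true,
      .hex false 1 false true, .hex false 0 false true, .hex false 0 true true,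
      .hex false 0 true false, .hex false 0 false false], ?_, rfl, rfl, ?_, ?_⟩
    · simp [Nbr, Step]
    · simp
    · rintro (⟨i, j, p, q⟩ | ⟨c, i, p, q⟩)
      · simp [Region]
      · cases c <;> cases p <;> cases q <;> simp [Region] <;> omega
  have h3 := h1.append (by simp [Nbr, Step]) (hasSpanningPath_hex k 2)
    (T := Region (fun _ _ => False) fun c j => j < 2 * k + 3 ∧ (c = true ∨ 2 ≤ j)) ?_ ?_
  · refine ⟨_, h3.append (by simp [Nbr, Step]) h2 ?_ ?_⟩
    · rintro (_ | ⟨_ | _, _, _, _⟩) <;> simp [Region]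
      omega
    · rintro (_ | ⟨_ | _, _, _, _⟩) <;> simp [Region]
      omega
  · rintro (_ | ⟨_ | _, _, _, _⟩) <;> simp [Region]
    omega
  · rintro (_ | ⟨_ | _, _, _, _⟩) <;> simp [Region] <;> omega

theorem exists_hasSpanningPath_valid {a : ℕ} (ha : a = 2 ∨ 4 ≤ a) :
    ∃ x y, HasSpanningPath Nbr (Valid a) x y := by
  have main : ∀ {x y z w}, HasSpanningPath Nbr (Region (fun _ _ => False) fun _ j => j < a) x y →
      Nbr z x → HasSpanningPath Nbr (Region (fun i j => i ≤ j ∧ j < a) fun _ _ => False) z w →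
      ∃ x y, HasSpanningPath Nbr (Valid a) x y := by
    intro x y z w h hzx h'
    refine ⟨_, _, (h.symm fun _ _ => Nbr.symm).append hzx.symm h' ?_ ?_⟩
    · rintro (_ | _) <;> simp [Region]
    · rintro (_ | _) <;> simp [Region, Valid]
  rcases Nat.even_or_odd' a with ⟨k, rfl | rfl⟩
  · obtain ⟨m, rfl⟩ : ∃ m, k = m + 1 := ⟨k - 1, by omega⟩
    obtain ⟨x, hx⟩ := exists_hasSpanningPath_hex_even m
    exact main hx (by simp [Nbr, Step]) (hasSpanningPath_fan_even m)
  -- Odd `a` is at least `5` here, matching the base case of the odd staircase.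
  · obtain ⟨m, rfl⟩ : ∃ m, k = m + 2 := ⟨k - 2, by omega⟩
    obtain ⟨x, hx⟩ := exists_hasSpanningPath_hex_odd (m + 1)
    exact main hx (by simp [Nbr, Step]) (hasSpanningPath_fan_odd m)

theorem Nbr.adj_toVertex {a : ℕ} {v w : {v : Node // v.Valid a}} (h : Nbr v.1 w.1) :
    (colorfulFlipGraph [a, 1, 1, 1, 1, 1]).Adj (toVertex a v) (toVertex a w) :=
  h.elim Step.adj_toVertex fun h => (Step.adj_toVertex h).symm

end Node

/-! ### Hamilton paths from lists -/

theorem hasHamiltonPath_of_list {V : Type*} [DecidableEq V] {G : SimpleGraph V} {l : List V}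
    (hne : l ≠ []) (hc : l.IsChain G.Adj) (hn : l.Nodup) (hl : ∀ v, v ∈ l) :
    HasHamiltonPath G := by
  refine ⟨_, _, SimpleGraph.Walk.ofSupport l hne hc, fun v => ?_⟩
  rw [SimpleGraph.Walk.support_ofSupport]
  exact List.count_eq_one_of_mem hn (hl v)

theorem hasHamiltonPath_colorfulFlipGraph {a : ℕ} (ha : a = 2 ∨ 4 ≤ a) :
    HasHamiltonPath (colorfulFlipGraph [a, 1, 1, 1, 1, 1]) := by
  obtain ⟨x, y, l, hc, hx, -, hn, hl⟩ := Node.exists_hasSpanningPath_valid ha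
  lift l to List {v : Node // v.Valid a} using fun v hv => (hl v).1 hv
  have hbij := Node.toVertex_bijective (a := a) (by omega)
  refine hasHamiltonPath_of_list (l := l.map (Node.toVertex a)) ?_ ?_ (hn.of_map.map hbij.1) ?_
  · intro h
    rw [List.map_eq_nil_iff] at h
    simp [h] at hx
  · rw [List.isChain_map] at hc ⊢
    exact hc.imp fun v w h => h.adj_toVertex
  · intro T
    obtain ⟨v, rfl⟩ := hbij.2 T
    obtain ⟨w, hw, hwv⟩ := List.mem_map.1 ((hl v.1).2 v.2)
    exact List.mem_map_of_mem (Subtype.ext hwv ▸ hw)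

theorem theorem5 :
    (∀ a : ℕ, 1 ≤ a → ¬ HasHamiltonCycle (colorfulFlipGraph [a, 1, 1, 1, 1, 1])) ∧
    (∀ a : ℕ, a = 2 ∨ 4 ≤ a → HasHamiltonPath (colorfulFlipGraph [a, 1, 1, 1, 1, 1])) :=
  ⟨fun _ => not_hasHamiltonCycle_colorfulFlipGraph, fun _ => hasHamiltonPath_colorfulFlipGraph⟩
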